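/- **Setting.** Fix a horizon $H\ge 1$, a number $k\ge 1$ of labelers and constants $B,L>0$ with $BL\ge 1$ (so that rewards of size $1$ are possible). An environment consists of measurable spaces of states $\mathcal S$ and actions $\mathcal A\neq\emptyset$, transition kernels $\mathcal P_h:\mathcal S\times\mathcal A\to\Delta(\mathcal S)$ $(h\le H)$, an initial state distribution $\rho$, and a measurable feature map $\phi:\mathcal S\times\mathcal A\to\mathbb R^d$ ($d$ arbitrary) with $\|\phi(s,a)\|_2\le L$; for $H=1$ it is a contextual bandit. A policy is $\pi=(\pi_h)_{h\le H}$ with $\pi_h:\mathcal S\to\Delta(\mathcal A)$. A reward parameter $\theta\in\mathbb R^d$ gives the reward $r_\theta(s,a)=\langle\theta,\phi(s,a)\rangle$ and the utility $J_\theta(\pi)=\mathbb E_{s_1\sim\rho}\big[\sum_{h=1}^H r_\theta(s_h,\pi_h(s_h))\big]$. For parameters $\theta_1^*,\dots,\theta_k^*$ of the labelers, $\|\theta_i^*\|_2\le B$, put $\mathcal W(\pi)=\frac1k\sum_{i=1}^k J_{\theta_i^*}(\pi)$ and $\mathrm{SubOpt}(\pi)=\sup_{\pi'}\mathcal W(\pi')-\mathcal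 W(\pi)$. Labeler $i$ is given fixed examples $(s^{i,j},\tau_0^{i,j},\tau_1^{i,j})$, $j\le n$, each an initial state with two trajectories. Labeling according to $\theta$ means drawing labels $o^{i,j}\in\{0,1\}$ independently from the Bradley–Terry model $\mathbb P_\theta(o=0\mid s,\tau_0,\tau_1)=\frac{\exp r_\theta(s,\tau_0)}{\exp r_\theta(s,\tau_0)+\exp r_\theta(s,\tau_1)}$, where $r_\theta(s,\tau)$ is the total reward along $\tau$ started in $s$. An RLHF algorithm maps an environment, the examples and the labels reported by all labelers to a policy $\hat\pi$, deterministically or at random (i.e. to a probability distribution over policies). It is strategyproof if in every environment, for all examples, every labeler $i$, all labels reported by the other labelers, and all $\theta_i^*,\tilde\theta_i$ of norm at most $B$, the expectation of $J_{\theta_i^*}(\hat\pi)$ when labeler $i$ labels according to $\theta_i^*$ is at least its expectation when labeler $i$ labels according to $\tilde\theta_i$. **Theorem.** Let $\hat\pi$ be the output of a strategyproof RLHF algorithm. Suppose that for every environment a number $n$ of samples and examples $(s^{i,j},\tau_0^{i,j},\tau_1^{i,j})_{i\le k,\,j\le n}$ are chosen, in any way whatsoever. Then the worst-case expected suboptimality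 under truthful labeling satisfies $$\sup\ \mathbb E\big[\mathrm{SubOpt}(\hat\pi)\big]\ \ge\ \frac{k-1}{k},$$ where the supremum is over all environments and all $\theta_1^*,\dots,\theta_k^*$ of norm at most $B$, and the expectation is over the labels $o^{i,j}\sim\mathbb P_{\theta_i^*}(\cdot\mid s^{i,j},\tau_0^{i,j},\tau_1^{i,j})$ (independent) and the randomness of the algorithm. -/

import Mathlib

open MeasureTheory ProbabilityTheory

noncomputable section

namespace RLHF

/-- A reward-free episodic MDP with horizon `H` together with a known feature embedding
`φ(s, a) ∈ ℝ^dim` satisfying `‖φ(s, a)‖₂ ≤ L`. For `H = 1` this is a contextual bandit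
(and the transitions play no role). -/
structure Env (H : ℕ) (L : ℝ) where
  State : Type
  Action : Type
  [mState : MeasurableSpace State]
  [mAction : MeasurableSpace Action]
  [action_nonempty : Nonempty Action]
  /-- transition functions `P_h : S × A → Δ(S)` -/
  transition : Fin H → Kernel (State × Action) State
  [transition_markov : ∀ h, IsMarkovKernel (transition h)]
  /-- initial state distribution `ρ` -/
  init : Measure State
  [init_prob : IsProbabilityMeasure init]
  dim : ℕ
  feature : State × Action → EuclideanSpace ℝ (Fin dim)
  feature_measurable : Measurable feature
  feature_bound : ∀ x, ‖feature x‖ ≤ L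

attribute [instance] Env.mState Env.mAction Env.action_nonempty Env.transition_markov
  Env.init_prob

/-- Reward parameters `θ ∈ ℝ^dim`. -/
abbrev Env.Param {H : ℕ} {L : ℝ} (E : Env H L) : Type := EuclideanSpace ℝ (Fin E.dim)

/-- The linear reward `r_θ(s, a) = ⟨θ, φ(s, a)⟩`. -/
def Env.reward {H : ℕ} {L : ℝ} (E : Env H L) (θ : E.Param) (s : E.State) (a : E.Action) : ℝ :=
  inner ℝ θ (E.feature (s, a))

/-- A (stochastic, history-independent) policy `π = (π_h)_{h ≤ H}`, `π_h : S → Δ(A)`. -/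
structure Policy {H : ℕ} {L : ℝ} (E : Env H L) where
  kernel : Fin H → Kernel E.State E.Action
  markov : ∀ h, IsMarkovKernel (kernel h)

/-- Law of the state reached after `h` steps under `π`, as a function of the initial state:
`s_{h+1} ∼ P_h(s_h, a_h)` with `a_h ∼ π_h(s_h)`. -/
def Policy.stateKernel {H : ℕ} {L : ℝ} {E : Env H L} (π : Policy E) :
    (h : ℕ) → h < H → Kernel E.State E.State
  | 0, _ => Kernel.id
  | h + 1, hh =>
      (E.transition ⟨h, Nat.lt_of_succ_lt hh⟩ ∘ₖ
          (Kernel.id ×ₖ π.kernel ⟨h, Nat.lt_of_succ_lt hh⟩)) ∘ₖ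
        π.stateKernel h (Nat.lt_of_succ_lt hh)

/-- Expected return `V_θ^π(s) = E[∑_h r_θ(s_h, π_h(s_h)) | s_1 = s]`, where
`r(s, π(s)) = E_{a ∼ π(·|s)} r(s, a)`. -/
def Policy.value {H : ℕ} {L : ℝ} {E : Env H L} (π : Policy E) (θ : E.Param) (s : E.State) : ℝ :=
  ∑ h : Fin H, ∫ s', ∫ a, E.reward θ s' a ∂(π.kernel h s') ∂(π.stateKernel h.1 h.2 s)

/-- Utility `J_θ(ρ, π) = E_{s ∼ ρ}[V_θ^π(s)]` of a labeler with reward parameter `θ`. -/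
def Policy.utility {H : ℕ} {L : ℝ} {E : Env H L} (π : Policy E) (θ : E.Param) : ℝ :=
  ∫ s, π.value θ s ∂E.init

/-- Average social welfare `W(ρ, π)` of labelers with reward parameters `θ 1, …, θ k`. -/
def Policy.welfare {H : ℕ} {L : ℝ} {E : Env H L} {k : ℕ} (π : Policy E)
    (θ : Fin k → E.Param) : ℝ :=
  (1 / (k : ℝ)) * ∑ i, π.utility (θ i)

/-- `SubOpt(ρ, π) = sup_{π'} W(ρ, π') - W(ρ, π)`. -/
def Policy.subOpt {H : ℕ} {L : ℝ} {E : Env H L} {k : ℕ} (π : Policy E)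
    (θ : Fin k → E.Param) : ℝ :=
  (⨆ π' : Policy E, π'.welfare θ) - π.welfare θ

/-- A random policy: a seed `ω` is drawn from `law`, and the policy indexed by `ω` is used.
A single (possibly stochastic) policy is the case of a one-point seed space. -/
structure RandomPolicy {H : ℕ} {L : ℝ} (E : Env H L) where
  Seed : Type
  [mSeed : MeasurableSpace Seed]
  law : Measure Seed
  [law_prob : IsProbabilityMeasure law]
  kernel : Fin H → Kernel (Seed × E.State) E.Action
  markov : ∀ h, IsMarkovKernel (kernel h)

attribute [instance] RandomPolicy.mSeed RandomPolicy.law_prob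

/-- The policy realized for the seed `ω`. -/
def RandomPolicy.realize {H : ℕ} {L : ℝ} {E : Env H L} (π : RandomPolicy E) (ω : π.Seed) :
    Policy E where
  kernel h := (π.kernel h).comap (fun s => (ω, s)) measurable_prodMk_left
  markov h := by
    have := π.markov h
    infer_instance

/-- Utility, in expectation over the seed. -/
def RandomPolicy.utility {H : ℕ} {L : ℝ} {E : Env H L} (π : RandomPolicy E) (θ : E.Param) : ℝ :=
  ∫ ω, (π.realize ω).utility θ ∂π.law

/-- Suboptimality, in expectation over the seed. -/
def RandomPolicy.subOpt {H : ℕ} {L : ℝ} {E : Env H L} {k : ℕ} (π : RandomPolicy E)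
    (θ : Fin k → E.Param) : ℝ :=
  ∫ ω, (π.realize ω).subOpt θ ∂π.law

/-- A trajectory `(a_1, s_2, a_2, …, s_H, a_H)`; `tail` lists `s_2, …, s_H`. -/
structure Trajectory {H : ℕ} {L : ℝ} (E : Env H L) where
  act : Fin H → E.Action
  tail : Fin (H - 1) → E.State

/-- The states `s_1 = s, s_2, …, s_H` along a trajectory that starts in `s`. -/
def Trajectory.stateAt {H : ℕ} {L : ℝ} {E : Env H L} (τ : Trajectory E) (s : E.State)
    (h : Fin H) : E.State :=
  if hh : h.1 = 0 then s else τ.tail ⟨h.1 - 1, by omega⟩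

/-- Total reward `r_θ(s, τ) = ∑_h r_θ(s_h, a_h)` of a trajectory. -/
def Trajectory.reward {H : ℕ} {L : ℝ} {E : Env H L} (τ : Trajectory E) (θ : E.Param)
    (s : E.State) : ℝ :=
  ∑ h, E.reward θ (τ.stateAt s h) (τ.act h)

/-- The pre-determined (unlabeled) examples `(s^{i,j}, τ_0^{i,j}, τ_1^{i,j})`,
`i ≤ k`, `j ≤ n`. -/
structure Examples {H : ℕ} {L : ℝ} (E : Env H L) (k : ℕ) where
  n : ℕ
  start : Fin k → Fin n → E.State
  traj : Fin k → Fin n → Fin 2 → Trajectory E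

/-- The preference labels of one labeler; label `0` means that `τ_0` is preferred. -/
abbrev Examples.Labels {H : ℕ} {L : ℝ} {E : Env H L} {k : ℕ} (X : Examples E k) : Type :=
  Fin X.n → Fin 2

/-- Bradley–Terry probability `P_θ(o^{i,j} = o | s^{i,j}, τ_0^{i,j}, τ_1^{i,j})`. -/
def Examples.bradleyTerry {H : ℕ} {L : ℝ} {E : Env H L} {k : ℕ} (X : Examples E k)
    (θ : E.Param) (i : Fin k) (j : Fin X.n) (o : Fin 2) : ℝ :=
  Real.exp ((X.traj i j o).reward θ (X.start i j)) /
    (Real.exp ((X.traj i j 0).reward θ (X.start i j)) +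
      Real.exp ((X.traj i j 1).reward θ (X.start i j)))

/-- Probability that labeler `i` produces the labels `o` when sampling each label
independently from `P_θ`. -/
def Examples.labelProb {H : ℕ} {L : ℝ} {E : Env H L} {k : ℕ} (X : Examples E k)
    (θ : E.Param) (i : Fin k) (o : X.Labels) : ℝ :=
  ∏ j, X.bradleyTerry θ i j (o j)

/-- An RLHF algorithm for `k` labelers: it knows the environment and the examples, and maps the
reported labels of all labelers to a (possibly random) policy. -/
abbrev Algorithm (H : ℕ) (L : ℝ) (k : ℕ) : Type 1 :=
  (E : Env H L) → (X : Examples E k) → (Fin k → X.Labels) → RandomPolicy E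

/-- Strategyproofness: for every labeler `i`, every true parameter `θ` and deviation `θ'` in the
ball of radius `B`, and all labels `o` reported by the others, sampling labels from `P_θ` is at
least as good for labeler `i`, in expectation, as sampling them from `P_θ'`. -/
def Algorithm.StrategyProof {H : ℕ} {L : ℝ} {k : ℕ} (alg : Algorithm H L k) (B : ℝ) : Prop :=
  ∀ (E : Env H L) (X : Examples E k) (i : Fin k) (o : Fin k → X.Labels) (θ θ' : E.Param),
    ‖θ‖ ≤ B → ‖θ'‖ ≤ B →
      ∑ oi : X.Labels, X.labelProb θ' i oi * (alg E X (Function.update o i oi)).utility θ ≤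
        ∑ oi : X.Labels, X.labelProb θ i oi * (alg E X (Function.update o i oi)).utility θ

/-- Expected suboptimality when each labeler `i` has the true parameter `θ i` and labels
truthfully; the expectation is over the labels and the internal randomness of the algorithm. -/
def Algorithm.expSubOpt {H : ℕ} {L : ℝ} {k : ℕ} (alg : Algorithm H L k) (E : Env H L)
    (X : Examples E k) (θ : Fin k → E.Param) : ℝ :=
  ∑ o : Fin k → X.Labels, (∏ i, X.labelProb (θ i) i (o i)) * (alg E X o).subOpt θ

/-- Worst-case expected suboptimality over all environments and all reward parameters in the
ball of radius `B`, where in the environment `E` the examples `design E` are labeled. -/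
def Algorithm.worstCaseSubOpt {H : ℕ} {L : ℝ} {k : ℕ} (alg : Algorithm H L k) (B : ℝ)
    (design : (E : Env H L) → Examples E k) : EReal :=
  ⨆ (E : Env H L) (θ : Fin k → E.Param) (_ : ∀ i, ‖θ i‖ ≤ B),
    ((alg.expSubOpt E (design E) θ : ℝ) : EReal)

end RLHF

end

open MeasureTheory ProbabilityTheory

noncomputable section

namespace RLHF

/-! ### Linearity of utility in the parameter, and the Bradley–Terry weights. -/

section General

variable {H : ℕ} {L : ℝ} {E : Env H L} {k : ℕ}

/-! Fix `θ`, one labeler and the labels of the others, and let `g c` be the expected `θ`-utility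
when that labeler labels according to `c • θ`. Utility is linear in the parameter, so
strategyproofness along this segment reads `c * g c' ≤ c * g c`. Hence `g` is constant on each side
of `0`. Bradley–Terry probabilities are continuous in the parameter, so the two constants agree and
`g 1 = g (-1)` (`Algorithm.StrategyProof.sum_labelProb_neg`).

Exchanging labelers one at a time (`sum_prod_mul_eq_of_update`), the unanimous profiles `θ` and `-θ`
give the same expected `θ`-utility `u`. In a bandit with two opposite actions their suboptimalities
are at least `H B L - u` and `H B L + u`, so one is at least `H B L ≥ 1`, which exceeds `(k - 1) /
k`. -/

theorem Env.reward_smul (c : ℝ) (θ : E.Param) (s : E.State) (a : E.Action) :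
    E.reward (c • θ) s a = c * E.reward θ s a := by
  simp [Env.reward, inner_smul_left]

theorem Policy.utility_smul (π : Policy E) (c : ℝ) (θ : E.Param) :
    π.utility (c • θ) = c * π.utility θ := by
  simp only [Policy.utility, Policy.value, Env.reward_smul, integral_const_mul, ← Finset.mul_sum]

theorem RandomPolicy.utility_smul (π : RandomPolicy E) (c : ℝ) (θ : E.Param) :
    π.utility (c • θ) = c * π.utility θ := by
  simp only [RandomPolicy.utility, Policy.utility_smul, integral_const_mul]

theorem Policy.welfare_const (hk : k ≠ 0) (π : Policy E) (θ : E.Param) :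
    π.welfare (fun _ : Fin k => θ) = π.utility θ := by
  have : (k : ℝ) ≠ 0 := by exact_mod_cast hk
  simp [Policy.welfare, this]

/-- The only property of the label model, besides being a probability, that the argument needs:
continuity glues the two half-segments at the parameter `0`. -/
theorem Examples.continuous_labelProb (X : Examples E k) (i : Fin k) (o : X.Labels) :
    Continuous fun θ => X.labelProb θ i o := by
  unfold Examples.labelProb Examples.bradleyTerry Trajectory.reward Env.reward
  refine continuous_finsetProd _ fun j _ => Continuous.div (by fun_prop) (by fun_prop) ?_
  intro θ
  positivity

theorem Examples.sum_bradleyTerry (X : Examples E k) (θ : E.Param) (i : Fin k) (j : Fin X.n) :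
    ∑ o, X.bradleyTerry θ i j o = 1 := by
  simp only [Examples.bradleyTerry, Fin.sum_univ_two]
  rw [← add_div]
  exact div_self (by positivity)

theorem Examples.sum_labelProb (X : Examples E k) (θ : E.Param) (i : Fin k) :
    ∑ o, X.labelProb θ i o = 1 := by
  simp only [Examples.labelProb]
  rw [← Fintype.prod_sum]
  exact Finset.prod_eq_one fun j _ => X.sum_bradleyTerry θ i j

theorem Examples.sum_prod_labelProb (X : Examples E k) (θ : Fin k → E.Param) :
    ∑ o : Fin k → X.Labels, ∏ i, X.labelProb (θ i) i (o i) = 1 := by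
  rw [← Fintype.prod_sum]
  simp [Examples.sum_labelProb]

end General

/-- If `c * g c' ≤ c * g c` on `[-1, 1]` and `g` is continuous, then `g` takes the same value at
`1` and `-1`: it is constant on each side of `0`, and continuous at `0`. -/
theorem eq_of_continuous_of_mul_le {g : ℝ → ℝ} (hg : Continuous g)
    (h : ∀ c c' : ℝ, |c| ≤ 1 → |c'| ≤ 1 → c * g c' ≤ c * g c) : g 1 = g (-1) := by
  have key : ∀ f : ℝ → ℝ, Continuous f →
      (∀ c c' : ℝ, |c| ≤ 1 → |c'| ≤ 1 → c * f c' ≤ c * f c) → f 0 = f 1 := by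
    intro f hf h
    have h1 : Filter.Tendsto f (nhdsWithin 0 (Set.Ioi 0)) (nhds (f 0)) :=
      hf.continuousAt.tendsto.mono_left nhdsWithin_le_nhds
    have h2 : Filter.Tendsto f (nhdsWithin 0 (Set.Ioi 0)) (nhds (f 1)) := by
      refine tendsto_const_nhds.congr' ?_
      filter_upwards [Ioc_mem_nhdsGT (zero_lt_one' ℝ)] with c hc
      have hc1 : |c| ≤ 1 := by rw [abs_of_pos hc.1]; exact hc.2
      -- Both `c` and `1` are positive and cancel, so deviations in either direction give the two
      -- inequalities.
      refine le_antisymm (le_of_mul_le_mul_left (h c 1 hc1 (by simp)) hc.1) ?_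
      simpa using h 1 c (by simp) hc1
    exact tendsto_nhds_unique h1 h2
  have hpos := key g hg h
  -- The reflection `c ↦ -g (-c)` inherits the hypothesis, which turns the left half into the right
  -- half.
  have hneg := key (fun c => - g (-c)) (by fun_prop) fun c c' hc hc' => by
    have := h (-c) (-c') (by simpa using hc) (by simpa using hc')
    linarith
  simp only [neg_zero, neg_inj] at hneg
  exact hpos.symm.trans hneg

/-- Expectations under product weights agree if each weight may be exchanged in every
coordinate with the other coordinates frozen. -/
theorem sum_prod_mul_eq_of_update {ι α : Type*} [Fintype ι] [DecidableEq ι] [Fintype α]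
    (p q : ι → α → ℝ) (f : (ι → α) → ℝ)
    (h : ∀ i (o : ι → α), ∑ a, p i a * f (Function.update o i a) =
      ∑ a, q i a * f (Function.update o i a)) :
    ∑ o : ι → α, (∏ i, p i (o i)) * f o = ∑ o : ι → α, (∏ i, q i (o i)) * f o := by
  have split : ∀ (i : ι) (w : ι → α → ℝ), ∑ o : ι → α, (∏ j, w j (o j)) * f o =
      ∑ r : {j // j ≠ i} → α, (∏ j : {j // j ≠ i}, w j (r j)) *
        ∑ a, w i a * f ((Equiv.funSplitAt i α).symm (a, r)) := by
    intro i w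
    rw [← (Equiv.funSplitAt i α).symm.sum_comp, Fintype.sum_prod_type, Finset.sum_comm]
    refine Finset.sum_congr rfl fun r _ => ?_
    rw [Finset.mul_sum]
    refine Finset.sum_congr rfl fun a _ => ?_
    rw [Fintype.prod_eq_mul_prod_subtype_ne _ i]
    have : ∀ j : {j // j ≠ i}, (Equiv.funSplitAt i α).symm (a, r) j = r j := fun j => by
      simp [Equiv.funSplitAt, Equiv.piSplitAt, j.2]
    simp only [this]
    simp [Equiv.funSplitAt, Equiv.piSplitAt]
    ring
  -- Hybrid argument: the coordinates in `s` already carry `q`, and each insertion exchanges one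
  -- more.
  have step : ∀ s : Finset ι, ∑ o : ι → α, (∏ i, p i (o i)) * f o =
      ∑ o : ι → α, (∏ i, (if i ∈ s then q i else p i) (o i)) * f o := by
    intro s
    induction s using Finset.induction_on with
    | empty => simp
    | insert i s hi ih =>
      rw [ih, split i, split i]
      refine Finset.sum_congr rfl fun r _ => ?_
      congr 1
      · refine Finset.prod_congr rfl fun j _ => ?_
        simp [Finset.mem_insert, j.2]
      · simp only [hi, if_false, Finset.mem_insert_self, if_true]
        rcases isEmpty_or_nonempty α with hα | ⟨⟨a₀⟩⟩
        · simp
        -- The filler `a₀` only completes `r` to a full tuple; the update at `i` overwrites it.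
        · have := h i ((Equiv.funSplitAt i α).symm (a₀, r))
          have hup : ∀ a, Function.update ((Equiv.funSplitAt i α).symm (a₀, r)) i a =
              (Equiv.funSplitAt i α).symm (a, r) := fun a => by
            ext j
            by_cases hj : j = i
            · subst hj; simp [Equiv.funSplitAt, Equiv.piSplitAt]
            · simp [Equiv.funSplitAt, Equiv.piSplitAt, hj]
          simpa only [hup] using this
  simpa using step Finset.univ

/-- Under a strategyproof algorithm a labeler cannot influence the expected utility in direction
`θ` by replacing `θ` with `-θ`. -/
theorem Algorithm.StrategyProof.sum_labelProb_neg {H : ℕ} {L : ℝ} {k : ℕ}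
    {alg : Algorithm H L k} {B : ℝ} (hsp : alg.StrategyProof B) {E : Env H L}
    (X : Examples E k) (i : Fin k) (o : Fin k → X.Labels) {θ : E.Param} (hθ : ‖θ‖ ≤ B) :
    ∑ a : X.Labels, X.labelProb θ i a * (alg E X (Function.update o i a)).utility θ =
      ∑ a : X.Labels, X.labelProb (-θ) i a *
        (alg E X (Function.update o i a)).utility θ := by
  have hnorm : ∀ c : ℝ, |c| ≤ 1 → ‖c • θ‖ ≤ B := fun c hc => by
    rw [norm_smul, Real.norm_eq_abs]
    exact (mul_le_of_le_one_left (norm_nonneg θ) hc).trans hθ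
  have := eq_of_continuous_of_mul_le
    (g := fun c => ∑ a : X.Labels, X.labelProb (c • θ) i a *
      (alg E X (Function.update o i a)).utility θ)
    (continuous_finsetSum _ fun a _ =>
      ((X.continuous_labelProb i a).comp (by fun_prop)).mul continuous_const)
    (fun c c' hc hc' => by
      have := hsp E X i o (c • θ) (c' • θ) (hnorm c hc) (hnorm c' hc')
      simp only [RandomPolicy.utility_smul, mul_left_comm _ c, ← Finset.mul_sum] at this
      exact this)
  simpa using this

/-! ### The two-action bandit. -/

/-- The bandit with a single state and two actions whose features are `L` and `-L`. -/
def signEnv (H : ℕ) (L : ℝ) (hL : 0 ≤ L) : Env H L where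
  State := Unit
  Action := Bool
  transition _ := Kernel.const _ (Measure.dirac ())
  init := Measure.dirac ()
  dim := 1
  feature x := EuclideanSpace.single 0 (if x.2 then L else -L)
  feature_measurable := measurable_of_countable _
  feature_bound x := by
    rw [PiLp.norm_single, Real.norm_eq_abs]
    split_ifs <;> simp [abs_of_nonneg hL]

section SignEnv

variable {H : ℕ} {L : ℝ} {hL : 0 ≤ L}

theorem isMarkovKernel_stateKernel {E : Env H L} (π : Policy E) (h : ℕ) (hh : h < H) :
    IsMarkovKernel (π.stateKernel h hh) := by
  induction h with
  | zero => unfold Policy.stateKernel; infer_instance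
  | succ h ih =>
    have := ih (Nat.lt_of_succ_lt hh)
    have := π.markov ⟨h, Nat.lt_of_succ_lt hh⟩
    unfold Policy.stateKernel
    infer_instance

/-- With a single state, the state law enters only through its total mass `1`. -/
theorem signEnv_utility (π : Policy (signEnv H L hL)) (θ : (signEnv H L hL).Param) :
    π.utility θ = ∑ h, ∫ a, (signEnv H L hL).reward θ () a ∂(π.kernel h ()) := by
  have hval : π.value θ () =
      ∑ h, ∫ a, (signEnv H L hL).reward θ () a ∂(π.kernel h ()) := by
    refine Finset.sum_congr rfl fun h _ => ?_
    have : IsProbabilityMeasure (π.stateKernel h.1 h.2 ()) :=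
      (isMarkovKernel_stateKernel π h.1 h.2).isProbabilityMeasure ()
    have hc : (fun s' : (signEnv H L hL).State =>
        ∫ a, (signEnv H L hL).reward θ s' a ∂(π.kernel h s')) =
        fun _ => ∫ a, (signEnv H L hL).reward θ () a ∂(π.kernel h ()) := rfl
    rw [hc, integral_const, probReal_univ, one_smul]
  have hc : π.value θ = fun _ => π.value θ () := rfl
  rw [Policy.utility, hc, integral_const, hval]
  simp

theorem abs_reward_le {E : Env H L} (θ : E.Param) (s : E.State) (a : E.Action) :
    |E.reward θ s a| ≤ ‖θ‖ * L :=
  (abs_real_inner_le_norm _ _).trans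
    (mul_le_mul_of_nonneg_left (E.feature_bound _) (norm_nonneg _))

theorem signEnv_abs_utility_le (π : Policy (signEnv H L hL)) (θ : (signEnv H L hL).Param) :
    |π.utility θ| ≤ H * (‖θ‖ * L) := by
  rw [signEnv_utility]
  calc _ ≤ ∑ h, |∫ a, (signEnv H L hL).reward θ () a ∂(π.kernel h ())| :=
        Finset.abs_sum_le_sum_abs _ _
    _ ≤ ∑ _h : Fin H, ‖θ‖ * L := Finset.sum_le_sum fun h _ => by
        have : IsProbabilityMeasure (π.kernel h ()) := (π.markov h).isProbabilityMeasure ()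
        have hle := norm_integral_le_of_norm_le_const (μ := π.kernel h ())
          (f := (signEnv H L hL).reward θ ())
          (Filter.Eventually.of_forall fun a => abs_reward_le θ () a)
        rwa [probReal_univ, mul_one] at hle
    _ = _ := by simp

/-- Needed to split the integral of the suboptimality over the seed. -/
theorem signEnv_integrable_utility (π : RandomPolicy (signEnv H L hL))
    (θ : (signEnv H L hL).Param) :
    Integrable (fun ω => (π.realize ω).utility θ) π.law := by
  refine Integrable.of_bound (C := H * (‖θ‖ * L)) ?_
    (Filter.Eventually.of_forall fun ω => signEnv_abs_utility_le _ _)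
  simp only [signEnv_utility]
  refine (Finset.stronglyMeasurable_fun_sum _ fun h _ => ?_).aestronglyMeasurable
  have := π.markov h
  have hr : StronglyMeasurable ((signEnv H L hL).reward θ ()) :=
    (measurable_of_countable (α := Bool) _).stronglyMeasurable
  exact (hr.integral_kernel (κ := π.kernel h)).comp_measurable
    (measurable_prodMk_right (y := (() : (signEnv H L hL).State)))

/-- The policy that always takes the action `b`. -/
def constPolicy (b : Bool) : Policy (signEnv H L hL) where
  kernel _ := Kernel.const _ (Measure.dirac (α := (signEnv H L hL).Action) b)
  markov _ := by
    have : IsProbabilityMeasure (Measure.dirac (α := (signEnv H L hL).Action) b) :=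
      Measure.dirac.isProbabilityMeasure
    exact ⟨fun _ => this⟩

/-- The parameter `c ∈ ℝ¹`. -/
def signParam (c : ℝ) : (signEnv H L hL).Param :=
  (EuclideanSpace.single (0 : Fin 1) c : EuclideanSpace ℝ (Fin 1))

theorem norm_signParam (c : ℝ) : ‖(signParam c : (signEnv H L hL).Param)‖ = |c| :=
  PiLp.norm_single _ _ _ _

theorem neg_signParam (c : ℝ) :
    -(signParam c : (signEnv H L hL).Param) = signParam (-c) :=
  (PiLp.single_neg 2 (β := fun _ : Fin 1 => ℝ) 0).symm

theorem signEnv_reward (c : ℝ) (b : Bool) :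
    (signEnv H L hL).reward (signParam c) () b = c * if b then L else -L := by
  change inner ℝ (EuclideanSpace.single (0 : Fin 1) c)
    (EuclideanSpace.single (0 : Fin 1) (if b then L else -L)) = _
  rw [EuclideanSpace.inner_single_left]
  simp

theorem constPolicy_utility (c : ℝ) (b : Bool) :
    (constPolicy b : Policy (signEnv H L hL)).utility (signParam c) =
      H * (c * if b then L else -L) := by
  rw [signEnv_utility]
  have : ∀ h : Fin H, ∫ a, (signEnv H L hL).reward (signParam c) () a
      ∂((constPolicy b : Policy (signEnv H L hL)).kernel h ()) = c * if b then L else -L := by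
    intro h
    rw [← signEnv_reward (H := H) (hL := hL)]
    exact integral_dirac' _ _ (measurable_of_countable (α := Bool) _).stronglyMeasurable
  simp [this]

theorem signEnv_le_iSup_welfare {k : ℕ} (hk : k ≠ 0) (c : ℝ) :
    H * (|c| * L) ≤
      ⨆ π : Policy (signEnv H L hL), π.welfare (fun _ : Fin k => signParam c) := by
  -- Without boundedness the real supremum would default to `0`.
  have hbdd : BddAbove (Set.range fun π : Policy (signEnv H L hL) =>
      π.welfare (fun _ : Fin k => signParam c)) := by
    refine ⟨H * (|c| * L), ?_⟩
    rintro _ ⟨π, rfl⟩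
    simp only [Policy.welfare_const hk]
    simpa only [norm_signParam] using (le_abs_self _).trans (signEnv_abs_utility_le π (signParam c))
  -- The action whose feature has the sign of `c` attains the bound.
  refine le_of_eq_of_le ?_ (le_ciSup hbdd (constPolicy (decide (0 ≤ c))))
  simp only [Policy.welfare_const hk, constPolicy_utility]
  by_cases hc : 0 ≤ c
  · simp [hc, abs_of_nonneg hc]
  · simp [hc, abs_of_neg (not_le.mp hc)]

theorem signEnv_le_subOpt {k : ℕ} (hk : k ≠ 0) (π : RandomPolicy (signEnv H L hL)) (c : ℝ) :
    H * (|c| * L) - π.utility (signParam c) ≤ π.subOpt (fun _ : Fin k => signParam c) := by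
  simp only [RandomPolicy.subOpt, Policy.subOpt]
  simp only [Policy.welfare_const hk _ (signParam c)]
  rw [integral_sub (integrable_const _) (signEnv_integrable_utility π _)]
  simp only [integral_const, probReal_univ, one_smul]
  have := signEnv_le_iSup_welfare (H := H) (hL := hL) hk c
  simp only [Policy.welfare_const hk _ (signParam c)] at this
  exact sub_le_sub_right this _

theorem Examples.labelProb_nonneg {E : Env H L} {k : ℕ} (X : Examples E k) (θ : E.Param)
    (i : Fin k) (o : X.Labels) : 0 ≤ X.labelProb θ i o :=
  Finset.prod_nonneg fun _ _ => by unfold Examples.bradleyTerry; positivity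

theorem signEnv_le_expSubOpt {k : ℕ} (hk : k ≠ 0) (alg : Algorithm H L k)
    (X : Examples (signEnv H L hL) k) (c : ℝ) :
    H * (|c| * L) - ∑ o : Fin k → X.Labels, (∏ i, X.labelProb (signParam c) i (o i)) *
        (alg _ X o).utility (signParam c) ≤
      alg.expSubOpt _ X (fun _ => signParam c) := by
  calc _ = ∑ o : Fin k → X.Labels, (∏ i, X.labelProb (signParam c) i (o i)) *
        (H * (|c| * L) - (alg _ X o).utility (signParam c)) := by
        simp only [mul_sub, Finset.sum_sub_distrib, ← Finset.sum_mul]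
        rw [X.sum_prod_labelProb fun _ => signParam c, one_mul]
    _ ≤ _ := Finset.sum_le_sum fun o _ => mul_le_mul_of_nonneg_left (signEnv_le_subOpt hk _ c)
        (Finset.prod_nonneg fun i _ => X.labelProb_nonneg _ i _)

/-- In the two-action bandit a strategyproof algorithm has expected suboptimality at least `H B L`
for one of the two unanimous profiles `B` and `-B`. -/
theorem Algorithm.StrategyProof.exists_le_expSubOpt {k : ℕ} (hk : k ≠ 0)
    {alg : Algorithm H L k} {B : ℝ} (hB : 0 ≤ B) (hsp : alg.StrategyProof B)
    (X : Examples (signEnv H L hL) k) :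
    ∃ c : ℝ, |c| = B ∧ H * (B * L) ≤ alg.expSubOpt _ X (fun _ => signParam c) := by
  have habs : |B| = B := abs_of_nonneg hB
  have heq := sum_prod_mul_eq_of_update (fun i => X.labelProb (signParam B) i)
    (fun i => X.labelProb (-signParam B) i) (fun o => (alg _ X o).utility (signParam B))
    (fun i o => hsp.sum_labelProb_neg X i o (by rw [norm_signParam, habs]))
  have hpos := signEnv_le_expSubOpt hk alg X B
  have hneg := signEnv_le_expSubOpt hk alg X (-B)
  have hu : ∀ π : RandomPolicy (signEnv H L hL),
      π.utility (signParam (-B)) = -π.utility (signParam B) := fun π => by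
    rw [← neg_signParam, ← neg_one_smul ℝ, RandomPolicy.utility_smul, neg_one_mul]
  simp only [hu, mul_neg, Finset.sum_neg_distrib, abs_neg, habs] at hpos hneg
  simp only [← neg_signParam B] at hneg
  rw [← heq] at hneg
  -- The sum is the common expected utility `u`; its sign decides which of `H B L - u` and `H B L +
  -- u` is large.
  rcases le_total (∑ o : Fin k → X.Labels, (∏ i, X.labelProb (signParam B) i (o i)) *
    (alg _ X o).utility (signParam B)) 0 with h | h
  · exact ⟨B, habs, by linarith⟩
  · exact ⟨-B, by rw [abs_neg, habs], by rw [← neg_signParam]; linarith⟩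

end SignEnv

end RLHF

end

theorem mainTheorem1 (H k : ℕ) (hH : 1 ≤ H) (hk : 1 ≤ k) (B L : ℝ) (hB : 0 < B)
    (hBL : 1 ≤ B * L) (alg : RLHF.Algorithm H L k) (hsp : alg.StrategyProof B)
    (design : (E : RLHF.Env H L) → RLHF.Examples E k) :
    ((((k : ℝ) - 1) / k : ℝ) : EReal) ≤ alg.worstCaseSubOpt B design := by
  have hL : 0 ≤ L := (pos_of_mul_pos_right (by linarith : 0 < B * L) hB.le).le
  obtain ⟨c, hc, hle⟩ := hsp.exists_le_expSubOpt (Nat.one_le_iff_ne_zero.mp hk) hB.le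
    (design (RLHF.signEnv H L hL))
  refine le_trans (EReal.coe_le_coe_iff.mpr ?_) <|
    le_iSup₂_of_le (RLHF.signEnv H L hL) (fun _ => RLHF.signParam c) <|
      le_iSup_of_le (fun _ => (RLHF.norm_signParam c).trans_le hc.le) le_rfl
  have hk' : (0 : ℝ) < k := by exact_mod_cast hk
  have hH' : (1 : ℝ) ≤ H := by exact_mod_cast hH
  have h1 : ((k : ℝ) - 1) / k ≤ 1 := by
    rw [div_le_one hk']
    linarith
  exact (h1.trans (one_le_mul_of_one_le_of_one_le hH' hBL)).trans hle
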